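/- Let $d\ge 1$, $\mathbb T^d=(\mathbb R/2\pi\mathbb Z)^d$, $s>d/2$, $T>0$, and let $\hat{\mathcal K}\subset\mathbb Z^d$ be an arbitrary finite set. Consider the defocusing cubic Schrödinger equation $$-i\partial_t u+\Delta u=|u|^2u+V(t,x),\qquad u|_{t=0}=u^0,\qquad V(t,x)=\sum_{k\in\hat{\mathcal K}}v_k(t)e^{ik\cdot x},$$ where $u^0\in H^s(\mathbb T^d)$ and the control functions $v_k$ are chosen freely in a class $\mathcal V\subseteq L^1([0,T];\mathbb C)$ (for example $\mathcal V=L^1([0,T];\mathbb C)$ or $\mathcal V=L^\infty([0,T];\mathbb C)$). A mild solution on $[0,T]$ is a function $u\in C([0,T];H^s(\mathbb T^d))$ such that $$u(t)=e^{-it\Delta}\Big(u^0+i\int_0^t e^{i\tau\Delta}\big(|u(\tau)|^2u(\tau)+V(\tau)\big)\,d\tau\Big)\qquad(0\le t\le T).$$ The attainable set $\mathcal A_{T,u^0}\subseteq H^s(\mathbb T^d)$ is the set of all $\hat u$ for which there are controls $v_k\in\mathcal V$, $k\in\hat{\mathcal K}$, such that a mild solution $u$ on $[0,T]$ exists, is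 unique, and satisfies $u(T)=\hat u$. Then, for every such $d$, $s$, $T$, $\hat{\mathcal K}$, $\mathcal V$ and every $u^0\in H^s(\mathbb T^d)$, the set $\mathcal A_{T,u^0}$ is contained in a countable union of compact subsets of $H^s(\mathbb T^d)$, and its complement $H^s(\mathbb T^d)\setminus\mathcal A_{T,u^0}$ is dense in $H^s(\mathbb T^d)$. In particular $\mathcal A_{T,u^0}\neq H^s(\mathbb T^d)$: the equation is not exactly controllable from $u^0$ in time $T$. -/

import Mathlib

open MeasureTheory Set

noncomputable section

namespace TorusNLS

/-! The torus `𝕋ᵈ = (ℝ / 2πℤ)ᵈ` is parametrized by `UnitAddTorus (Fin d) = (ℝ / ℤ)ᵈ` through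
`x = 2π y`.  In this parametrization the function `x ↦ exp (i k · x)` is
`UnitAddTorus.mFourier k`, and the Laplacian in the variable `x` satisfies
`Δ exp (i k · x) = - |k|² exp (i k · x)`. -/

/-- The normalized Lebesgue (Haar) measure on the torus. -/
def torusMeasure (d : ℕ) : Measure (UnitAddTorus (Fin d)) :=
  Measure.pi fun _ => AddCircle.haarAddCircle

/-- The complex Hilbert space `L²(𝕋ᵈ)`. -/
abbrev L2Torus (d : ℕ) : Type := Lp ℂ 2 (torusMeasure d)

/-- The Hilbert basis `(exp (i k · x))`, `k ∈ ℤᵈ`, of `L²(𝕋ᵈ)`. -/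
def modeBasis (d : ℕ) : HilbertBasis (Fin d → ℤ) ℂ (L2Torus d) :=
  UnitAddTorus.mFourierBasis

/-- The `k`-th element of the basis is the class of the function `exp (i k · x)`. -/
theorem coeFn_modeBasis {d : ℕ} (k : Fin d → ℤ) :
    (modeBasis d k : UnitAddTorus (Fin d) → ℂ) =ᵐ[torusMeasure d]
      fun x => UnitAddTorus.mFourier k x := by
  have h := UnitAddTorus.coeFn_mFourierLp (d := Fin d) 2 k
  rw [← congrFun (UnitAddTorus.coe_mFourierBasis (d := Fin d)) k] at h
  exact h

/-- The `k`-th Fourier coefficient of `f ∈ L²(𝕋ᵈ)`. -/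
def coeff {d : ℕ} (f : L2Torus d) (k : Fin d → ℤ) : ℂ := (modeBasis d).repr f k

/-- Fourier coefficients are given by the usual integral `∫ exp (- i k · x) f(x) dx`. -/
theorem coeff_eq_integral {d : ℕ} (f : L2Torus d) (k : Fin d → ℤ) :
    coeff f k = ∫ x, UnitAddTorus.mFourier (-k) x * f x ∂(torusMeasure d) :=
  UnitAddTorus.mFourierBasis_repr f k

/-- `|k|² = k₁² + ⋯ + k_d²`. -/
def normSq {d : ℕ} (k : Fin d → ℤ) : ℝ := ∑ i, (k i : ℝ) ^ 2

theorem normSq_nonneg {d : ℕ} (k : Fin d → ℤ) : 0 ≤ normSq k :=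
  Finset.sum_nonneg fun _ _ => sq_nonneg _

/-- The weight `(1 + |k|²)^(s/2)`. -/
def weight {d : ℕ} (s : ℝ) (k : Fin d → ℤ) : ℝ := (1 + normSq k) ^ (s / 2)

theorem weight_pos {d : ℕ} (s : ℝ) (k : Fin d → ℤ) : 0 < weight s k :=
  Real.rpow_pos_of_pos (by linarith [normSq_nonneg k]) _

theorem one_le_weight {d : ℕ} {s : ℝ} (hs : 0 ≤ s) (k : Fin d → ℤ) : 1 ≤ weight s k :=
  Real.one_le_rpow (by linarith [normSq_nonneg k]) (by linarith)

/-- The functions `f ∈ L²(𝕋ᵈ)` with `∑ₖ (1 + |k|²)^s |f̂(k)|² < ∞`, that is, for `s ≥ 0`, those of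
the Sobolev space `H^s(𝕋ᵈ)`. -/
def sobolevSubmodule (d : ℕ) (s : ℝ) : Submodule ℂ (L2Torus d) where
  carrier := {f | Memℓp (fun k : Fin d → ℤ => (weight s k : ℂ) * coeff f k) 2}
  zero_mem' := by
    have h : (fun k : Fin d → ℤ => (weight s k : ℂ) * coeff (0 : L2Torus d) k) = 0 := by
      funext k; simp [coeff]
    simpa only [mem_ofPred_eq, h] using zero_memℓp
  add_mem' := by
    intro f g hf hg
    have h := hf.add hg
    simp only [mem_ofPred_eq]
    convert h using 1
    funext k; simp [coeff, mul_add]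
  smul_mem' := by
    intro c f hf
    have h := hf.const_smul c
    simp only [mem_ofPred_eq]
    convert h using 1
    funext k
    simp [coeff, mul_left_comm]

/-- The Sobolev space `H^s(𝕋ᵈ)`, `s ≥ 0`.  (A definition rather than an abbreviation: it does not
carry the norm of `L²(𝕋ᵈ)` but the `H^s`-norm defined below.) -/
def Sobolev (d : ℕ) (s : ℝ) : Type := sobolevSubmodule d s

instance (d : ℕ) (s : ℝ) : AddCommGroup (Sobolev d s) :=
  inferInstanceAs (AddCommGroup (sobolevSubmodule d s))

instance (d : ℕ) (s : ℝ) : Module ℂ (Sobolev d s) :=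
  inferInstanceAs (Module ℂ (sobolevSubmodule d s))

/-- The inclusion `H^s(𝕋ᵈ) ⊆ L²(𝕋ᵈ)`. -/
def Sobolev.toL2 {d : ℕ} {s : ℝ} : Sobolev d s →ₗ[ℂ] L2Torus d := (sobolevSubmodule d s).subtype

/-- The map `f ↦ ((1 + |k|²)^(s/2) f̂(k))ₖ` from `H^s(𝕋ᵈ)` to `ℓ²(ℤᵈ)`. -/
def Sobolev.toSeq {d : ℕ} {s : ℝ} : Sobolev d s →ₗ[ℂ] lp (fun _ : Fin d → ℤ => ℂ) 2 where
  toFun f := ⟨fun k => (weight s k : ℂ) * coeff f.toL2 k, f.2⟩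
  map_add' f g := by
    ext k
    simp only [map_add, coeff, lp.coeFn_add, Pi.add_apply, mul_add]
  map_smul' c f := by
    ext k
    simp [coeff, mul_left_comm]

theorem Sobolev.toL2_injective {d : ℕ} {s : ℝ} :
    Function.Injective (Sobolev.toL2 : Sobolev d s → L2Torus d) := Subtype.val_injective

theorem Sobolev.toSeq_apply {d : ℕ} {s : ℝ} (f : Sobolev d s) (k : Fin d → ℤ) :
    Sobolev.toSeq f k = (weight s k : ℂ) * coeff f.toL2 k := rfl

theorem Sobolev.toSeq_injective {d : ℕ} {s : ℝ} :
    Function.Injective (Sobolev.toSeq : Sobolev d s → lp (fun _ : Fin d → ℤ => ℂ) 2) := by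
  intro f g h
  apply Sobolev.toL2_injective
  apply (modeBasis d).repr.injective
  ext k
  have hk : Sobolev.toSeq f k = Sobolev.toSeq g k := by rw [h]
  rw [Sobolev.toSeq_apply, Sobolev.toSeq_apply] at hk
  exact mul_left_cancel₀ (by exact_mod_cast (weight_pos s k).ne') hk

/-- The norm of `H^s(𝕋ᵈ)`: `‖f‖² = ∑ₖ (1 + |k|²)^s |f̂(k)|²`. -/
instance (d : ℕ) (s : ℝ) : NormedAddCommGroup (Sobolev d s) :=
  NormedAddCommGroup.induced (Sobolev d s) (lp (fun _ : Fin d → ℤ => ℂ) 2) Sobolev.toSeq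
    Sobolev.toSeq_injective

instance (d : ℕ) (s : ℝ) : NormedSpace ℂ (Sobolev d s) :=
  NormedSpace.induced ℂ (Sobolev d s) (lp (fun _ : Fin d → ℤ => ℂ) 2) Sobolev.toSeq

theorem Sobolev.norm_toSeq {d : ℕ} {s : ℝ} (f : Sobolev d s) : ‖Sobolev.toSeq f‖ = ‖f‖ := rfl

/-- The explicit form of the `H^s`-norm. -/
theorem Sobolev.hasSum_norm_sq {d : ℕ} {s : ℝ} (f : Sobolev d s) :
    HasSum (fun k : Fin d → ℤ => (1 + normSq k) ^ s * ‖coeff f.toL2 k‖ ^ 2) (‖f‖ ^ 2) := by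
  have h := lp.hasSum_norm (p := 2) (by norm_num) (Sobolev.toSeq f)
  simp only [ENNReal.toReal_ofNat, Real.rpow_two, Sobolev.norm_toSeq, Sobolev.toSeq_apply] at h
  convert h using 2 with k
  have h0 : 0 ≤ 1 + normSq k := by linarith [normSq_nonneg k]
  have hw : weight s k ^ 2 = (1 + normSq k) ^ s := by
    rw [weight, ← Real.rpow_natCast, ← Real.rpow_mul h0]
    norm_num
  rw [norm_mul, mul_pow, Complex.norm_real, Real.norm_of_nonneg (weight_pos s k).le, hw]

/-- A sequence that is dominated by a square-summable one belongs to `ℓ²`. -/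
theorem memlp_of_norm_le {ι : Type} {a b : ι → ℂ} (hb : Memℓp b 2) (h : ∀ k, ‖a k‖ ≤ ‖b k‖) :
    Memℓp a 2 := by
  have h2 : (0 : ℝ) < (2 : ENNReal).toReal := by norm_num
  refine memℓp_gen (Summable.of_nonneg_of_le (fun _ => by positivity) (fun k => ?_)
    (hb.summable h2))
  exact Real.rpow_le_rpow (norm_nonneg _) (h k) h2.le

/-- For `s ≥ 0` the map `f ↦ ((1 + |k|²)^(s/2) f̂(k))ₖ` is onto `ℓ²(ℤᵈ)`. -/
theorem Sobolev.toSeq_surjective {d : ℕ} {s : ℝ} (hs : 0 ≤ s) :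
    Function.Surjective (Sobolev.toSeq : Sobolev d s → lp (fun _ : Fin d → ℤ => ℂ) 2) := by
  intro a
  have hw : ∀ k : Fin d → ℤ, (weight s k : ℂ) ≠ 0 := fun k => by
    exact_mod_cast (weight_pos s k).ne'
  have hb : Memℓp (fun k => (weight s k : ℂ)⁻¹ * a k) 2 := by
    refine memlp_of_norm_le (lp.memℓp a) fun k => ?_
    rw [norm_mul, norm_inv, Complex.norm_real, Real.norm_of_nonneg (weight_pos s k).le]
    exact mul_le_of_le_one_left (norm_nonneg _) (inv_le_one_of_one_le₀ (one_le_weight hs k))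
  let f : L2Torus d := (modeBasis d).repr.symm ⟨_, hb⟩
  have hf : ∀ k, (weight s k : ℂ) * coeff f k = a k := fun k => by
    simp [f, coeff, mul_inv_cancel_left₀ (hw k)]
  refine ⟨⟨f, ?_⟩, ?_⟩
  · have h : Memℓp (fun k => (weight s k : ℂ) * coeff f k) 2 := by
      rw [funext hf]; exact lp.memℓp a
    exact h
  · ext k
    exact hf k

/-- `H^s(𝕋ᵈ)` is complete. -/
theorem Sobolev.completeSpace {d : ℕ} {s : ℝ} (hs : 0 ≤ s) : CompleteSpace (Sobolev d s) := by
  have hi : Isometry (Sobolev.toSeq : Sobolev d s → lp (fun _ : Fin d → ℤ => ℂ) 2) :=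
    AddMonoidHomClass.isometry_of_norm _ Sobolev.norm_toSeq
  exact (IsometryEquiv.mk' _ (Function.surjInv (Sobolev.toSeq_surjective hs))
    (Function.surjInv_eq _) hi).completeSpace

/-- The function `exp (i k · x)` as an element of `H^s(𝕋ᵈ)`. -/
def mode (d : ℕ) (s : ℝ) (k : Fin d → ℤ) : Sobolev d s :=
  ⟨modeBasis d k, by
    have h : Memℓp (fun l : Fin d → ℤ => (weight s l : ℂ) * coeff (modeBasis d k) l) 2 := by
      refine memlp_of_norm_le
        (lp.memℓp ((weight s k : ℂ) • lp.single (E := fun _ : Fin d → ℤ => ℂ) 2 k (1 : ℂ)))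
        fun l => ?_
      rw [coeff, (modeBasis d).repr_self]
      by_cases hl : l = k
      · subst hl; exact le_rfl
      · simp [hl]
    exact h⟩

/-- The group `e^{-itΔ}` on `L²(𝕋ᵈ)`: it multiplies the `k`-th Fourier coefficient by
`exp (i |k|² t)`. -/
def freeFlowL2 {d : ℕ} (t : ℝ) (f : L2Torus d) : L2Torus d :=
  (modeBasis d).repr.symm
    ⟨fun k => Complex.exp (Complex.I * (normSq k * t : ℝ)) * coeff f k,
      memlp_of_norm_le (lp.memℓp ((modeBasis d).repr f)) fun k => by
        rw [norm_mul, mul_comm Complex.I, Complex.norm_exp_ofReal_mul_I, one_mul]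
        exact le_rfl⟩

theorem coeff_freeFlowL2 {d : ℕ} (t : ℝ) (f : L2Torus d) (k : Fin d → ℤ) :
    coeff (freeFlowL2 t f) k = Complex.exp (Complex.I * (normSq k * t : ℝ)) * coeff f k := by
  simp [coeff, freeFlowL2]

/-- The group `e^{-itΔ}` on `H^s(𝕋ᵈ)`; `t ↦ e^{-itΔ} f` solves `-i ∂ₜ u + Δ u = 0`, `u(0) = f`. -/
def freeFlow {d : ℕ} {s : ℝ} (t : ℝ) (f : Sobolev d s) : Sobolev d s :=
  ⟨freeFlowL2 t f.toL2, by
    have h : Memℓp (fun k => (weight s k : ℂ) * coeff (freeFlowL2 t f.toL2) k) 2 := by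
      refine memlp_of_norm_le (lp.memℓp (Sobolev.toSeq f)) fun k => ?_
      rw [coeff_freeFlowL2, Sobolev.toSeq_apply, norm_mul, norm_mul, norm_mul,
        mul_comm Complex.I, Complex.norm_exp_ofReal_mul_I, one_mul]
    exact h⟩

/-- `g = |u|² u` as functions on the torus. -/
def IsCubic {d : ℕ} {s : ℝ} (u g : Sobolev d s) : Prop :=
  (g.toL2 : UnitAddTorus (Fin d) → ℂ) =ᵐ[torusMeasure d]
    fun x => ((‖u.toL2 x‖ ^ 2 : ℝ) : ℂ) * u.toL2 x

/-- The source term `V(t, x) = ∑_{k ∈ K} vₖ(t) exp (i k · x)`. -/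
def source {d : ℕ} (s : ℝ) (K : Finset (Fin d → ℤ)) (v : (Fin d → ℤ) → ℝ → ℂ) (t : ℝ) :
    Sobolev d s :=
  ∑ k ∈ K, v k t • mode d s k

/-- `u ∈ C([0, T]; H^s(𝕋ᵈ))` is a mild solution of
`-i ∂ₜ u + Δ u = |u|² u + V`, `u(0) = u₀`, on `[0, T]`, that is,
`u(t) = e^{-itΔ} (u₀ + i ∫₀ᵗ e^{iτΔ} (|u(τ)|² u(τ) + V(τ)) dτ)` for `0 ≤ t ≤ T`.
Here `G τ` is the function `|u(τ)|² u(τ)`, an element of `H^s(𝕋ᵈ)`. -/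
def IsMildSolution {d : ℕ} {s : ℝ} (T : ℝ) (V : ℝ → Sobolev d s) (u₀ : Sobolev d s)
    (u : ℝ → Sobolev d s) : Prop :=
  ContinuousOn u (Icc 0 T) ∧
    ∃ G : ℝ → Sobolev d s,
      (∀ τ ∈ Icc 0 T, IsCubic (u τ) (G τ)) ∧
      IntervalIntegrable (fun τ => freeFlow (-τ) (G τ + V τ)) volume 0 T ∧
      ∀ t ∈ Icc 0 T,
        u t = freeFlow t (u₀ + Complex.I • ∫ τ in (0 : ℝ)..t, freeFlow (-τ) (G τ + V τ))

/-- The source term `V` steers the equation from `u₀` to `û` in time `T`: a mild solution on `[0, T]`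
exists, is unique, and takes the value `û` at time `T`. -/
def Steers {d : ℕ} {s : ℝ} (T : ℝ) (V : ℝ → Sobolev d s) (u₀ û : Sobolev d s) : Prop :=
  ∃ u : ℝ → Sobolev d s, IsMildSolution T V u₀ u ∧
    (∀ u' : ℝ → Sobolev d s, IsMildSolution T V u₀ u' → EqOn u' u (Icc 0 T)) ∧
    u T = û

/-- The time-`T` attainable set from `u₀`, when the modes in `K` are controlled and the control
functions `vₖ`, `k ∈ K`, are chosen in the class `𝒱` of functions. -/
def attainableSet {d : ℕ} {s : ℝ} (K : Finset (Fin d → ℤ)) (𝒱 : Set (ℝ → ℂ)) (T : ℝ)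
    (u₀ : Sobolev d s) : Set (Sobolev d s) :=
  {û | ∃ v : (Fin d → ℤ) → ℝ → ℂ, (∀ k ∈ K, v k ∈ 𝒱) ∧ Steers T (source s K v) u₀ û}

/-- Global exact controllability from `u₀` in time `T`: every point of `H^s(𝕋ᵈ)` is attainable. -/
def ExactlyControllable {d : ℕ} {s : ℝ} (K : Finset (Fin d → ℤ)) (𝒱 : Set (ℝ → ℂ)) (T : ℝ)
    (u₀ : Sobolev d s) : Prop :=
  attainableSet K 𝒱 T u₀ = univ

end TorusNLS

end

/-!
Since the controlled modes form a finite set, the controls enter the equation only through finitely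
many scalar primitives. In Duhamel's formula the source contributes
`e^{-itΔ} (i ∑ₖ Φₖ(t) e^{ik·x})`, where `Φₖ(t) = ∫₀ᵗ e^{-i|k|²τ} vₖ(τ) dτ`. The map
`vₖ ↦ Φₖ` is compact from `L¹` to `L¹`, and `Φₖ(T)` is one complex number. The solution at time `T`
depends continuously on these data, so bounded controls lead to a precompact set of final states.

* *Nonlinearity.* For `s > d / 2` the weights `(1 + |k|²)^(-s)` are summable, so Fourier series of
  `H^s` functions converge absolutely (`exists_tsum_coeff_le`). With the inequality
  `weight (k + l) ≤ 2 ^ s (weight k + weight l)` and Young's inequality `ℓ¹ * ℓ² ⊆ ℓ²`, this makes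
  `H^s(𝕋ᵈ)` an algebra (`exists_mul`), on which `u ↦ |u|² u` is locally Lipschitz
  (`exists_norm_cubic_sub_le`).
* *Stability.* For two mild solutions in a common ball, Duhamel's formula and Grönwall's
  inequality bound `‖u(T) - y(T)‖` by the `L¹` norm on `[0, T]` and the value at `T` of the
  differences of the primitives (`norm_sub_le_of_isMildSolution`).
* *Compactness.* Sampling the primitives at `N + 1` equally spaced times determines them in `L¹` up
  to `O(1 / N)`, uniformly for controls bounded in `L¹` (`integral_norm_primitive_le`), and the
  samples lie in a bounded subset of a finite-dimensional space. Hence the set reached with controls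
  of `L¹` norm at most `n` along solutions in the ball of radius `n` is totally bounded
  (`totallyBounded_boundedReach`). The attainable set is covered by these sets, `n ∈ ℕ`.
* *Density of the complement.* `H^s(𝕋ᵈ)` is infinite-dimensional, so compact sets have empty
  interior, and Baire's theorem applies.

No existence theory is needed: only final states of solutions that are given enter the argument.
-/

noncomputable section

namespace TorusNLS

variable {d : ℕ} {s : ℝ}

/-! ### Weights and weighted sequences -/

theorem weight_neg (s : ℝ) (k : Fin d → ℤ) : weight s (-k) = weight s k := by
  simp [weight, normSq]

theorem norm_sq_le_normSq (k : Fin d → ℤ) : ‖(fun i => (k i : ℝ))‖ ^ 2 ≤ normSq k := by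
  have h : ‖(fun i => (k i : ℝ))‖ ≤ Real.sqrt (normSq k) := by
    refine (pi_norm_le_iff_of_nonneg (Real.sqrt_nonneg _)).2 fun i => ?_
    refine Real.le_sqrt_of_sq_le ?_
    rw [Real.norm_eq_abs, sq_abs]
    exact Finset.single_le_sum (f := fun i => (k i : ℝ) ^ 2) (fun _ _ => sq_nonneg _)
      (Finset.mem_univ i)
  calc _ ≤ Real.sqrt (normSq k) ^ 2 := by gcongr
    _ = _ := Real.sq_sqrt (normSq_nonneg k)

/-- This is where `s > d / 2` enters: `∑ₖ (1 + |k|²)^(-s) < ∞`. -/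
theorem summable_weight_inv_sq (hs : (d : ℝ) / 2 < s) :
    Summable fun k : Fin d → ℤ => (weight s k)⁻¹ ^ 2 := by
  have hs0 : 0 < s := lt_of_le_of_lt (by positivity) hs
  let L : Submodule ℤ (Fin d → ℝ) := Submodule.span ℤ (range (Pi.basisFun ℝ (Fin d)))
  have hL : Module.finrank ℤ L = d := by
    rw [ZLattice.rank ℝ L]; simp
  have hsum := ZLattice.summable_norm_rpow L (-(2 * s)) (by rw [hL]; linarith)
  have hmem : ∀ k : Fin d → ℤ, (fun i => (k i : ℝ)) ∈ L := fun k => by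
    rw [Module.Basis.mem_span_iff_repr_mem]
    exact fun i => ⟨k i, by simp⟩
  let φ : (Fin d → ℤ) → L := fun k => ⟨_, hmem k⟩
  have hφ : Function.Injective φ := fun k l h => by
    funext i
    have : (k i : ℝ) = l i := congrFun (congrArg Subtype.val h) i
    exact_mod_cast this
  -- Compare with `‖k‖ ^ (-2 s)`, which has the junk value `0` at `k = 0`.
  refine Summable.of_norm_bounded_eventually (hsum.comp_injective hφ) ?_
  have h0 : ∀ᶠ k : Fin d → ℤ in Filter.cofinite, k ≠ 0 := by
    simp [Filter.eventually_cofinite]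
  filter_upwards [h0] with k hk
  have hk' : 0 < ‖(fun i => (k i : ℝ))‖ := by
    rw [norm_pos_iff]
    contrapose! hk
    funext i
    have : (k i : ℝ) = 0 := congrFun hk i
    exact_mod_cast this
  have hle : ‖(fun i => (k i : ℝ))‖ ^ 2 ≤ 1 + normSq k := by linarith [norm_sq_le_normSq k]
  have hpos : 0 < 1 + normSq k := by linarith [normSq_nonneg k]
  have e1 : (weight s k)⁻¹ ^ 2 = (1 + normSq k) ^ (-s) := by
    rw [weight, inv_pow, ← Real.rpow_natCast, ← Real.rpow_mul hpos.le, Real.rpow_neg hpos.le]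
    norm_num
  have e2 : ‖(fun i => (k i : ℝ))‖ ^ (-(2 * s)) = (‖(fun i => (k i : ℝ))‖ ^ 2) ^ (-s) := by
    rw [← Real.rpow_natCast, ← Real.rpow_mul hk'.le]
    norm_num
  rw [Real.norm_of_nonneg (by positivity), e1]
  change _ ≤ ‖(fun i => (k i : ℝ))‖ ^ (-(2 * s))
  rw [e2]
  exact Real.rpow_le_rpow_of_nonpos (by positivity) hle (by linarith)

theorem weight_add_le (hs : 0 ≤ s) (k l : Fin d → ℤ) :
    weight s (k + l) ≤ 2 ^ s * (weight s k + weight s l) := by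
  have hk := normSq_nonneg k
  have hl := normSq_nonneg l
  have h1 : normSq (k + l) ≤ 2 * normSq k + 2 * normSq l := by
    simp only [normSq, Finset.mul_sum, ← Finset.sum_add_distrib]
    refine Finset.sum_le_sum fun i _ => ?_
    push_cast [Pi.add_apply]
    nlinarith [sq_nonneg ((k i : ℝ) - l i)]
  have key : ∀ a b : ℝ, 0 ≤ a → a ≤ b → normSq (k + l) ≤ 2 * a + 2 * b →
      weight s (k + l) ≤ 2 ^ s * (1 + b) ^ (s / 2) := fun a b ha hab h => by
    have : (2 : ℝ) ^ s = 4 ^ (s / 2) := by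
      rw [show (4 : ℝ) = 2 ^ (2 : ℝ) by norm_num, ← Real.rpow_mul (by norm_num)]
      congr 1; ring
    rw [this, ← Real.mul_rpow (by norm_num) (by linarith)]
    exact Real.rpow_le_rpow (by linarith [normSq_nonneg (k + l)]) (by linarith) (by linarith)
  have h2 : (0 : ℝ) ≤ 2 ^ s := by positivity
  rcases le_total (normSq k) (normSq l) with h | h
  · exact (key _ _ hk h h1).trans
      (mul_le_mul_of_nonneg_left (by change weight s l ≤ _; linarith [weight_pos s k]) h2)
  · exact (key _ _ hl h (by linarith)).trans
      (mul_le_mul_of_nonneg_left (by change weight s k ≤ _; linarith [weight_pos s l]) h2)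

/-- Young's inequality `ℓ¹ * ℓ² ⊆ ℓ²` for real sequences on an abelian group. -/
theorem exists_lp_hasSum_convolution {ι : Type*} [AddCommGroup ι] {b : ι → ℝ} (hb0 : ∀ l, 0 ≤ b l)
    (hb : Summable b) (a : lp (fun _ : ι => ℝ) 2) :
    ∃ c : lp (fun _ : ι => ℝ) 2, ‖c‖ ≤ (∑' l, b l) * ‖a‖ ∧
      ∀ m, HasSum (fun l => b l * a (m - l)) (c m) := by
  have h2 : (0 : ℝ) < (2 : ENNReal).toReal := by norm_num
  have hmem : ∀ l, Memℓp (fun m => a (m - l)) 2 := fun l =>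
    memℓp_gen (((lp.memℓp a).summable h2).comp_injective (sub_left_injective (b := l)))
  let S : ι → lp (fun _ : ι => ℝ) 2 := fun l => ⟨_, hmem l⟩
  have hS : ∀ l, ‖S l‖ = ‖a‖ := fun l => by
    rw [lp.norm_eq_tsum_rpow h2, lp.norm_eq_tsum_rpow h2]
    congr 1
    exact (Equiv.subRight l).tsum_eq (fun m => ‖a m‖ ^ (2 : ENNReal).toReal)
  have hn : ∀ l, ‖b l • S l‖ = b l * ‖a‖ := fun l => by
    rw [norm_smul, hS, Real.norm_of_nonneg (hb0 l)]
  have hsn : Summable fun l => ‖b l • S l‖ := by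
    simp only [hn]; exact hb.mul_right _
  refine ⟨∑' l, b l • S l, ?_, fun m => ?_⟩
  · refine (norm_tsum_le_tsum_norm hsn).trans (le_of_eq ?_)
    simp only [hn, tsum_mul_right]
  · exact (lp.evalCLM ℝ (fun _ : ι => ℝ) 2 m).hasSum hsn.of_norm.hasSum

/-! ### Absolutely convergent Fourier series -/

instance (d : ℕ) : IsProbabilityMeasure (torusMeasure d) :=
  inferInstanceAs (IsProbabilityMeasure (Measure.pi fun _ => AddCircle.haarAddCircle))

/-- The class in `L²(𝕋ᵈ)` of a continuous function. -/
def ofCont (d : ℕ) : C(UnitAddTorus (Fin d), ℂ) →L[ℂ] L2Torus d :=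
  ContinuousMap.toLp 2 (torusMeasure d) ℂ

theorem coeFn_ofCont (F : C(UnitAddTorus (Fin d), ℂ)) : ofCont d F =ᵐ[torusMeasure d] F :=
  ContinuousMap.coeFn_toLp _ F

theorem ofCont_mFourier (k : Fin d → ℤ) :
    ofCont d (UnitAddTorus.mFourier k) = modeBasis d k :=
  Lp.ext ((coeFn_ofCont _).trans (coeFn_modeBasis k).symm)

/-- The Fourier coefficient as a continuous linear functional on `L²(𝕋ᵈ)`. -/
def coeffCLM (k : Fin d → ℤ) : L2Torus d →L[ℂ] ℂ :=
  (lp.evalCLM ℂ (fun _ : Fin d → ℤ => ℂ) 2 k).comp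
    (modeBasis d).repr.toContinuousLinearEquiv.toContinuousLinearMap

theorem coeffCLM_apply (k : Fin d → ℤ) (f : L2Torus d) : coeffCLM k f = coeff f k := rfl

theorem coeff_ofCont (F : C(UnitAddTorus (Fin d), ℂ)) (k : Fin d → ℤ) :
    coeff (ofCont d F) k = ∫ x, UnitAddTorus.mFourier (-k) x * F x ∂(torusMeasure d) := by
  rw [coeff_eq_integral]
  refine integral_congr_ae ?_
  filter_upwards [coeFn_ofCont F] with x hx
  rw [hx]

/-- An `L²` function with absolutely summable Fourier coefficients is continuous. -/
theorem exists_hasSum_mFourier {f : L2Torus d} (hf : Summable fun k => ‖coeff f k‖) :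
    ∃ F : C(UnitAddTorus (Fin d), ℂ),
      HasSum (fun k => coeff f k • UnitAddTorus.mFourier k) F ∧ ofCont d F = f := by
  have h : Summable fun k => coeff f k • (UnitAddTorus.mFourier k : C(UnitAddTorus (Fin d), ℂ)) :=
    .of_norm (by simpa only [norm_smul, UnitAddTorus.mFourier_norm, mul_one] using hf)
  refine ⟨_, h.hasSum, ?_⟩
  have h1 := (ofCont d).hasSum h.hasSum
  simp only [map_smul, ofCont_mFourier] at h1
  exact h1.unique ((modeBasis d).hasSum_repr f)

/-- The Fourier coefficients of a product are the convolution of those of the factors. -/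
theorem hasSum_coeff_mul {a : (Fin d → ℤ) → ℂ} {F : C(UnitAddTorus (Fin d), ℂ)}
    (hF : HasSum (fun k => a k • UnitAddTorus.mFourier k) F) (G : C(UnitAddTorus (Fin d), ℂ))
    (m : Fin d → ℤ) :
    HasSum (fun l => a l * coeff (ofCont d G) (m - l)) (coeff (ofCont d (F * G)) m) := by
  have h := ((coeffCLM m).comp (ofCont d)).hasSum (hF.mul_right G)
  refine h.congr_fun fun l => ?_
  simp only [smul_mul_assoc, map_smul, smul_eq_mul,
    ContinuousLinearMap.comp_apply, coeffCLM_apply, coeff_ofCont]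
  congr 1
  refine integral_congr_ae (Filter.Eventually.of_forall fun x => ?_)
  simp only [ContinuousMap.mul_apply]
  rw [← mul_assoc, ← UnitAddTorus.mFourier_add, neg_sub, neg_add_eq_sub]

/-- The Fourier coefficients of the complex conjugate of `f`. -/
theorem coeff_ofCont_star (F : C(UnitAddTorus (Fin d), ℂ)) (k : Fin d → ℤ) :
    coeff (ofCont d (star F)) k = star (coeff (ofCont d F) (-k)) := by
  rw [coeff_ofCont, coeff_ofCont]
  change _ = (starRingEnd ℂ) _
  rw [← integral_conj]
  refine integral_congr_ae (Filter.Eventually.of_forall fun x => ?_)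
  simp [UnitAddTorus.mFourier_neg]

/-! ### The algebra property of `H^s(𝕋ᵈ)`, `s > d / 2` -/

/-- For `s > d / 2` the Fourier series of an `H^s` function converges absolutely, with a bound
by the `H^s`-norm. -/
theorem exists_tsum_coeff_le (hs : (d : ℝ) / 2 < s) :
    ∃ C : ℝ, 0 ≤ C ∧ ∀ f : Sobolev d s, Summable (fun k => ‖coeff f.toL2 k‖) ∧
      ∑' k, ‖coeff f.toL2 k‖ ≤ C * ‖f‖ := by
  have h2 : (0 : ℝ) < (2 : ENNReal).toReal := by norm_num
  have hW : Memℓp (fun k : Fin d → ℤ => (((weight s k)⁻¹ : ℝ) : ℂ)) 2 := by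
    refine memℓp_gen ?_
    simpa using summable_weight_inv_sq hs
  have hpq : (2 : ENNReal).toReal.HolderConjugate (2 : ENNReal).toReal := by
    norm_num; exact Real.HolderConjugate.two_two
  refine ⟨‖(⟨_, hW⟩ : lp (fun _ : Fin d → ℤ => ℂ) 2)‖, norm_nonneg _, fun f => ?_⟩
  have h := lp.tsum_mul_le_mul_norm hpq (⟨_, hW⟩ : lp (fun _ : Fin d → ℤ => ℂ) 2) (Sobolev.toSeq f)
  have e : ∀ k, ‖(⟨_, hW⟩ : lp (fun _ : Fin d → ℤ => ℂ) 2) k‖ * ‖Sobolev.toSeq f k‖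
      = ‖coeff f.toL2 k‖ := fun k => by
    change ‖(((weight s k)⁻¹ : ℝ) : ℂ)‖ * _ = _
    rw [← norm_mul, Sobolev.toSeq_apply, Complex.ofReal_inv, inv_mul_cancel_left₀]
    exact_mod_cast (weight_pos s k).ne'
  simpa only [e, Sobolev.norm_toSeq] using h

/-- An `L²` function whose weighted coefficients are dominated by an `ℓ²` sequence is in `H^s`. -/
theorem exists_sobolev_of_norm_le {f : L2Torus d} {c : lp (fun _ : Fin d → ℤ => ℝ) 2}
    (h : ∀ k, weight s k * ‖coeff f k‖ ≤ c k) : ∃ g : Sobolev d s, g.toL2 = f ∧ ‖g‖ ≤ ‖c‖ := by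
  have h2 : (0 : ℝ) < (2 : ENNReal).toReal := by norm_num
  have h' : ∀ k, ‖(weight s k : ℂ) * coeff f k‖ ≤ ‖c k‖ := fun k => by
    rw [norm_mul, Complex.norm_real, Real.norm_of_nonneg (weight_pos s k).le]
    exact (h k).trans (le_abs_self _)
  have hmem : Memℓp (fun k => (weight s k : ℂ) * coeff f k) 2 :=
    memℓp_gen (Summable.of_nonneg_of_le (fun _ => by positivity)
      (fun k => Real.rpow_le_rpow (norm_nonneg _) (h' k) h2.le) ((lp.memℓp c).summable h2))
  exact ⟨⟨f, hmem⟩, rfl, lp.norm_mono (x := Sobolev.toSeq (⟨f, hmem⟩ : sobolevSubmodule d s))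
    (by norm_num) h'⟩

/-- The absolute values of the weighted coefficients, with the same `ℓ²` norm. -/
theorem exists_lp_norm_weight_mul (f : Sobolev d s) :
    ∃ p : lp (fun _ : Fin d → ℤ => ℝ) 2, ‖p‖ = ‖f‖ ∧
      ∀ k, p k = weight s k * ‖coeff f.toL2 k‖ := by
  have h2 : (0 : ℝ) < (2 : ENNReal).toReal := by norm_num
  have e : ∀ k, ‖Sobolev.toSeq f k‖ = weight s k * ‖coeff f.toL2 k‖ := fun k => by
    rw [Sobolev.toSeq_apply, norm_mul, Complex.norm_real, Real.norm_of_nonneg (weight_pos s k).le]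
  have hmem : Memℓp (fun k => ‖Sobolev.toSeq f k‖) 2 :=
    memℓp_gen (by simpa using (lp.memℓp (Sobolev.toSeq f)).summable h2)
  refine ⟨⟨_, hmem⟩, ?_, e⟩
  rw [← Sobolev.norm_toSeq, lp.norm_eq_tsum_rpow h2, lp.norm_eq_tsum_rpow h2]
  simp

/-- `H^s(𝕋ᵈ)` is stable under complex conjugation. -/
theorem exists_star (hs : (d : ℝ) / 2 < s) (f : Sobolev d s) :
    ∃ g : Sobolev d s, ‖g‖ ≤ ‖f‖ ∧ g.toL2 =ᵐ[torusMeasure d] fun x => star (f.toL2 x) := by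
  obtain ⟨C, -, hC⟩ := exists_tsum_coeff_le hs
  obtain ⟨F, -, hF⟩ := exists_hasSum_mFourier (hC f).1
  obtain ⟨p, hp, hpk⟩ := exists_lp_norm_weight_mul f
  have h2 : (0 : ℝ) < (2 : ENNReal).toReal := by norm_num
  have hmem : Memℓp (fun k => p (-k)) 2 :=
    memℓp_gen (((lp.memℓp p).summable h2).comp_injective neg_injective)
  have hn : ‖(⟨_, hmem⟩ : lp (fun _ : Fin d → ℤ => ℝ) 2)‖ = ‖f‖ := by
    rw [← hp, lp.norm_eq_tsum_rpow h2, lp.norm_eq_tsum_rpow h2]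
    congr 1
    exact (Equiv.neg _).tsum_eq (fun m => ‖p m‖ ^ (2 : ENNReal).toReal)
  obtain ⟨g, hg, hgn⟩ := exists_sobolev_of_norm_le (s := s) (f := ofCont d (star F))
    (c := ⟨_, hmem⟩) fun k => by
      change _ ≤ p (-k)
      rw [hpk, weight_neg, coeff_ofCont_star, norm_star, hF]
  refine ⟨g, hgn.trans hn.le, ?_⟩
  rw [hg, ← hF]
  filter_upwards [coeFn_ofCont F, coeFn_ofCont (star F)] with x h1 h3
  rw [h1, h3]; rfl

/-- For `s > d / 2` the space `H^s(𝕋ᵈ)` is an algebra under pointwise multiplication. -/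
theorem exists_mul (hs : (d : ℝ) / 2 < s) :
    ∃ C : ℝ, 0 ≤ C ∧ ∀ f g : Sobolev d s, ∃ h : Sobolev d s, ‖h‖ ≤ C * (‖f‖ * ‖g‖) ∧
      h.toL2 =ᵐ[torusMeasure d] fun x => f.toL2 x * g.toL2 x := by
  have hs0 : 0 ≤ s := le_trans (by positivity) hs.le
  obtain ⟨C, hC0, hC⟩ := exists_tsum_coeff_le hs
  refine ⟨2 ^ s * (2 * C), by positivity, fun f g => ?_⟩
  obtain ⟨F, hFs, hF⟩ := exists_hasSum_mFourier (hC f).1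
  obtain ⟨G, -, hG⟩ := exists_hasSum_mFourier (hC g).1
  obtain ⟨p, hp, hpk⟩ := exists_lp_norm_weight_mul f
  obtain ⟨q, hq, hqk⟩ := exists_lp_norm_weight_mul g
  obtain ⟨A, hA, hAs⟩ := exists_lp_hasSum_convolution (fun _ => norm_nonneg _) (hC f).1 q
  obtain ⟨B, hB, hBs⟩ := exists_lp_hasSum_convolution (fun _ => norm_nonneg _) (hC g).1 p
  have hAn : ‖A‖ ≤ C * ‖f‖ * ‖g‖ :=
    hA.trans (by rw [hq]; exact mul_le_mul_of_nonneg_right (hC f).2 (norm_nonneg _))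
  have hBn : ‖B‖ ≤ C * ‖g‖ * ‖f‖ :=
    hB.trans (by rw [hp]; exact mul_le_mul_of_nonneg_right (hC g).2 (norm_nonneg _))
  obtain ⟨h, hh, hhn⟩ := exists_sobolev_of_norm_le (s := s) (f := ofCont d (F * G))
    (c := (2 : ℝ) ^ s • (B + A)) fun m => by
      have hc := hasSum_coeff_mul hFs G m
      rw [hG] at hc
      -- `weight m ≤ 2 ^ s (weight l + weight (m - l))` puts the weight on one factor at a time,
      -- leaving the other one in `ℓ¹`.
      have hBs' : HasSum (fun l => ‖coeff g.toL2 (m - l)‖ * p l) (B m) := by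
        have := (Equiv.subLeft m).hasSum_iff.2 (hBs m)
        simpa [Function.comp_def] using this
      have hsum := ((hBs'.add (hAs m)).mul_left ((2 : ℝ) ^ s))
      have hle : ∀ l, ‖(weight s m : ℂ) * (coeff f.toL2 l * coeff g.toL2 (m - l))‖ ≤
          2 ^ s * (‖coeff g.toL2 (m - l)‖ * p l + ‖coeff f.toL2 l‖ * q (m - l)) := fun l => by
        have hw := weight_add_le hs0 l (m - l)
        rw [add_sub_cancel] at hw
        rw [norm_mul, norm_mul, Complex.norm_real, Real.norm_of_nonneg (weight_pos s m).le, hpk,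
          hqk]
        calc _ ≤ 2 ^ s * (weight s l + weight s (m - l)) *
              (‖coeff f.toL2 l‖ * ‖coeff g.toL2 (m - l)‖) := by gcongr
          _ = _ := by ring
      have := (hc.mul_left (weight s m : ℂ)).norm_le_of_bounded hsum hle
      rwa [norm_mul, Complex.norm_real, Real.norm_of_nonneg (weight_pos s m).le] at this
  refine ⟨h, hhn.trans ?_, ?_⟩
  · rw [norm_smul, Real.norm_of_nonneg (by positivity), mul_assoc]
    refine mul_le_mul_of_nonneg_left ((norm_add_le _ _).trans ?_) (by positivity)
    linarith
  · rw [hh, ← hF, ← hG]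
    filter_upwards [coeFn_ofCont F, coeFn_ofCont G, coeFn_ofCont (F * G)] with x h1 h2 h3
    rw [h1, h2, h3]; rfl

/-- Local Lipschitz continuity of the cubic nonlinearity in `H^s(𝕋ᵈ)`. -/
theorem exists_norm_cubic_sub_le (hs : (d : ℝ) / 2 < s) :
    ∃ C : ℝ, 0 ≤ C ∧ ∀ (R : ℝ) (u w g h : Sobolev d s), ‖u‖ ≤ R → ‖w‖ ≤ R →
      IsCubic u g → IsCubic w h → ‖g - h‖ ≤ C * R ^ 2 * ‖u - w‖ := by
  obtain ⟨C, hC0, hC⟩ := exists_mul hs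
  have tri : ∀ a b c : Sobolev d s, ∃ h : Sobolev d s, ‖h‖ ≤ C ^ 2 * (‖a‖ * ‖b‖ * ‖c‖) ∧
      h.toL2 =ᵐ[torusMeasure d] fun x => a.toL2 x * star (b.toL2 x) * c.toL2 x := fun a b c => by
    obtain ⟨b', hb', hb⟩ := exists_star hs b
    obtain ⟨m, hmn, hm⟩ := hC a b'
    obtain ⟨h, hhn, hh⟩ := hC m c
    refine ⟨h, hhn.trans ?_, ?_⟩
    · calc C * (‖m‖ * ‖c‖) ≤ C * (C * (‖a‖ * ‖b‖) * ‖c‖) := by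
            gcongr
            exact hmn.trans (by gcongr)
        _ = _ := by ring
    · filter_upwards [hb, hm, hh] with x h1 h2 h3
      rw [h3, h2, h1]
  refine ⟨3 * C ^ 2, by positivity, fun R u w g h hu hw hg hh => ?_⟩
  have hR : 0 ≤ R := (norm_nonneg _).trans hu
  obtain ⟨x₁, hn₁, hx₁⟩ := tri (u - w) u u
  obtain ⟨x₂, hn₂, hx₂⟩ := tri w (u - w) u
  obtain ⟨x₃, hn₃, hx₃⟩ := tri w w (u - w)
  -- `|u|²u - |w|²w = (u - w) ū u + w (ū - w̄) u + w w̄ (u - w)`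
  have e : g - h = x₁ + x₂ + x₃ := by
    apply Sobolev.toL2_injective
    refine Lp.ext ?_
    rw [map_sub, map_add, map_add]
    have hg' : g.toL2 =ᵐ[torusMeasure d] _ := hg
    have hh' : h.toL2 =ᵐ[torusMeasure d] _ := hh
    rw [map_sub] at hx₁ hx₂ hx₃
    filter_upwards [Lp.coeFn_sub g.toL2 h.toL2, Lp.coeFn_add (x₁.toL2 + x₂.toL2) x₃.toL2,
      Lp.coeFn_add x₁.toL2 x₂.toL2, hx₁, hx₂, hx₃, Lp.coeFn_sub u.toL2 w.toL2, hg', hh'] with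
      x h1 h2 h3 h4 h5 h6 h7 h8 h9
    simp only [Pi.add_apply, Pi.sub_apply] at h1 h2 h3 h7
    rw [h1, h2, h3, h4, h5, h6, h7, h8, h9]
    have sq : ∀ z : ℂ, ((‖z‖ ^ 2 : ℝ) : ℂ) = star z * z := fun z => by
      rw [← Complex.normSq_eq_norm_sq, Complex.normSq_eq_conj_mul_self]; rfl
    rw [sq, sq, star_sub]
    ring
  have hd0 := norm_nonneg (u - w)
  rw [e]
  calc ‖x₁ + x₂ + x₃‖ ≤ ‖x₁‖ + ‖x₂‖ + ‖x₃‖ := norm_add₃_le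
    _ ≤ C ^ 2 * (‖u - w‖ * R * R) + C ^ 2 * (R * ‖u - w‖ * R) + C ^ 2 * (R * R * ‖u - w‖) := by
        gcongr
        · exact hn₁.trans (by gcongr)
        · exact hn₂.trans (by gcongr)
        · exact hn₃.trans (by gcongr)
    _ = _ := by ring

/-! ### The free flow and the source term -/

theorem toSeq_freeFlow (t : ℝ) (f : Sobolev d s) (k : Fin d → ℤ) :
    Sobolev.toSeq (freeFlow t f) k =
      Complex.exp (Complex.I * (normSq k * t : ℝ)) * Sobolev.toSeq f k := by
  change (weight s k : ℂ) * coeff (freeFlowL2 t f.toL2) k = _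
  rw [coeff_freeFlowL2, Sobolev.toSeq_apply, mul_left_comm]

theorem norm_freeFlow (t : ℝ) (f : Sobolev d s) : ‖freeFlow t f‖ = ‖f‖ := by
  have e : ∀ k, ‖Sobolev.toSeq (freeFlow t f) k‖ = ‖Sobolev.toSeq f k‖ := fun k => by
    rw [toSeq_freeFlow, norm_mul, mul_comm Complex.I, Complex.norm_exp_ofReal_mul_I, one_mul]
  rw [← Sobolev.norm_toSeq, ← Sobolev.norm_toSeq f]
  exact le_antisymm (lp.norm_mono (by norm_num) fun k => (e k).le)
    (lp.norm_mono (by norm_num) fun k => (e k).ge)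

theorem freeFlow_add (t : ℝ) (f g : Sobolev d s) :
    freeFlow t (f + g) = freeFlow t f + freeFlow t g := by
  apply Sobolev.toSeq_injective
  ext k
  simp only [map_add, lp.coeFn_add, Pi.add_apply, toSeq_freeFlow, mul_add]

theorem freeFlow_smul (t : ℝ) (c : ℂ) (f : Sobolev d s) :
    freeFlow t (c • f) = c • freeFlow t f := by
  apply Sobolev.toSeq_injective
  ext k
  simp only [map_smul, lp.coeFn_smul, Pi.smul_apply, toSeq_freeFlow, smul_eq_mul, mul_left_comm]

/-- The free flow as a linear isometry of `H^s(𝕋ᵈ)`. -/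
def freeFlowₗᵢ (t : ℝ) : Sobolev d s →ₗᵢ[ℂ] Sobolev d s where
  toFun := freeFlow t
  map_add' := freeFlow_add t
  map_smul' := freeFlow_smul t
  norm_map' := norm_freeFlow t

theorem freeFlow_sub (t : ℝ) (f g : Sobolev d s) :
    freeFlow t (f - g) = freeFlow t f - freeFlow t g :=
  map_sub (freeFlowₗᵢ t) f g

theorem freeFlow_mode (t : ℝ) (k : Fin d → ℤ) :
    freeFlow t (mode d s k) = Complex.exp (Complex.I * (normSq k * t : ℝ)) • mode d s k := by
  apply Sobolev.toSeq_injective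
  ext l
  simp only [map_smul, lp.coeFn_smul, Pi.smul_apply, toSeq_freeFlow, smul_eq_mul]
  by_cases h : l = k
  · rw [h]
  · have : Sobolev.toSeq (mode d s k) l = 0 := by
      rw [Sobolev.toSeq_apply]
      change _ * ((modeBasis d).repr (modeBasis d k)) l = 0
      rw [(modeBasis d).repr_self]
      simp [h]
    rw [this, mul_zero, mul_zero]

theorem norm_mode_le (k : Fin d → ℤ) : ‖mode d s k‖ ≤ weight s k := by
  have e : Sobolev.toSeq (mode d s k) =
      lp.single (E := fun _ : Fin d → ℤ => ℂ) 2 k (weight s k : ℂ) := by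
    ext l
    rw [Sobolev.toSeq_apply]
    change _ * ((modeBasis d).repr (modeBasis d k)) l = _
    rw [(modeBasis d).repr_self]
    by_cases h : l = k
    · subst h; simp
    · simp [h]
  rw [← Sobolev.norm_toSeq, e, lp.norm_single (by norm_num), Complex.norm_real,
    Real.norm_of_nonneg (weight_pos s k).le]

theorem linearIndependent_mode (d : ℕ) (s : ℝ) : LinearIndependent ℂ (mode d s) :=
  LinearIndependent.of_comp Sobolev.toL2 (modeBasis d).orthonormal.linearIndependent

/-- The factor `exp (- i |k|² τ)` by which `e^{iτΔ}` acts on the `k`-th mode. -/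
def phase (k : Fin d → ℤ) (τ : ℝ) : ℂ := Complex.exp (Complex.I * (normSq k * -τ : ℝ))

theorem norm_phase (k : Fin d → ℤ) (τ : ℝ) : ‖phase k τ‖ = 1 := by
  rw [phase, mul_comm Complex.I, Complex.norm_exp_ofReal_mul_I]

theorem continuous_phase (k : Fin d → ℤ) : Continuous (phase k) := by
  unfold phase; fun_prop

theorem freeFlow_neg_source (K : Finset (Fin d → ℤ)) (v : (Fin d → ℤ) → ℝ → ℂ) (τ : ℝ) :
    freeFlow (-τ) (source s K v τ) = ∑ k ∈ K, (phase k τ * v k τ) • mode d s k := by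
  change freeFlowₗᵢ (-τ) _ = _
  rw [source, map_sum]
  refine Finset.sum_congr rfl fun k _ => ?_
  rw [map_smul]
  change v k τ • freeFlow (-τ) (mode d s k) = _
  rw [freeFlow_mode, smul_smul, mul_comm]
  rfl

theorem intervalIntegrable_phase_mul {v : ℝ → ℂ} {a b : ℝ} (hv : IntervalIntegrable v volume a b)
    (k : Fin d → ℤ) : IntervalIntegrable (fun τ => phase k τ * v τ) volume a b :=
  hv.continuousOn_mul (continuous_phase k).continuousOn

theorem intervalIntegrable_phase_mul_smul_mode {v : ℝ → ℂ} {a b : ℝ}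
    (hv : IntervalIntegrable v volume a b) (k : Fin d → ℤ) :
    IntervalIntegrable (fun τ => (phase k τ * v τ) • mode d s k) volume a b :=
  ⟨(intervalIntegrable_phase_mul hv k).1.smul_const _,
    (intervalIntegrable_phase_mul hv k).2.smul_const _⟩

theorem intervalIntegrable_freeFlow_source {K : Finset (Fin d → ℤ)} {v : (Fin d → ℤ) → ℝ → ℂ}
    {a b : ℝ} (hv : ∀ k ∈ K, IntervalIntegrable (v k) volume a b) :
    IntervalIntegrable (fun τ => freeFlow (-τ) (source s K v τ)) volume a b := by
  simp only [freeFlow_neg_source]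
  exact ⟨integrable_finsetSum K fun k hk => (intervalIntegrable_phase_mul_smul_mode (hv k hk) k).1,
    integrable_finsetSum K fun k hk => (intervalIntegrable_phase_mul_smul_mode (hv k hk) k).2⟩

theorem integral_freeFlow_source (hs : 0 ≤ s) {K : Finset (Fin d → ℤ)} {v : (Fin d → ℤ) → ℝ → ℂ}
    {a b : ℝ} (hv : ∀ k ∈ K, IntervalIntegrable (v k) volume a b) :
    ∫ τ in a..b, freeFlow (-τ) (source s K v τ) =
      ∑ k ∈ K, (∫ τ in a..b, phase k τ * v k τ) • mode d s k := by
  have := Sobolev.completeSpace (d := d) hs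
  simp only [freeFlow_neg_source]
  rw [intervalIntegral.integral_finsetSum fun k hk =>
    intervalIntegrable_phase_mul_smul_mode (hv k hk) k]
  exact Finset.sum_congr rfl fun k _ => intervalIntegral.integral_smul_const _ _

/-! ### Scalar integral inequalities -/

/-- Grönwall's inequality in integrated form. -/
theorem integral_le_exp_mul_integral {T L : ℝ} (hT : 0 ≤ T) (hL : 0 ≤ L) {D φ : ℝ → ℝ}
    (hD : ContinuousOn D (Icc 0 T)) (hφ : ContinuousOn φ (Icc 0 T))
    (hφ0 : ∀ t ∈ Icc 0 T, 0 ≤ φ t)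
    (h : ∀ t ∈ Icc 0 T, D t ≤ L * (∫ τ in (0 : ℝ)..t, D τ) + φ t) :
    ∫ τ in (0 : ℝ)..T, D τ ≤ Real.exp (L * T) * ∫ τ in (0 : ℝ)..T, φ τ := by
  wlog hc : Continuous D ∧ Continuous φ generalizing D φ
  · have e : ∀ (f : ℝ → ℝ), ∀ t ∈ Icc 0 T, IccExtend hT ((Icc 0 T).domRestrict f) t = f t :=
      fun f t ht => by rw [IccExtend_of_mem hT _ ht]; rfl
    have ei : ∀ (f : ℝ → ℝ), ∀ t ∈ Icc 0 T,
        ∫ τ in (0 : ℝ)..t, IccExtend hT ((Icc 0 T).domRestrict f) τ = ∫ τ in (0 : ℝ)..t, f τ :=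
      fun f t ht => intervalIntegral.integral_congr fun τ hτ => by
        rw [uIcc_of_le ht.1] at hτ
        exact e f τ ⟨hτ.1, hτ.2.trans ht.2⟩
    have hD' : Continuous (IccExtend hT ((Icc 0 T).domRestrict D)) := hD.domRestrict.Icc_extend'
    have hφ' : Continuous (IccExtend hT ((Icc 0 T).domRestrict φ)) := hφ.domRestrict.Icc_extend'
    have := this hD'.continuousOn hφ'.continuousOn (fun t ht => by rw [e φ t ht]; exact hφ0 t ht)
      (fun t ht => by rw [e D t ht, e φ t ht, ei D t ht]; exact h t ht) ⟨hD', hφ'⟩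
    rwa [ei D T ⟨hT, le_rfl⟩, ei φ T ⟨hT, le_rfl⟩] at this
  obtain ⟨hD, hφ⟩ := hc
  -- The hypothesis makes this function decreasing, and it vanishes at `0`.
  let f : ℝ → ℝ := fun t => Real.exp (-L * t) * (∫ τ in (0 : ℝ)..t, D τ) - ∫ τ in (0 : ℝ)..t, φ τ
  have hf : ∀ t, HasDerivAt f (Real.exp (-L * t) * (-L) * (∫ τ in (0 : ℝ)..t, D τ) +
      Real.exp (-L * t) * D t - φ t) t := fun t => by
    have h1 : HasDerivAt (fun t => Real.exp (-L * t)) (Real.exp (-L * t) * (-L)) t := by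
      simpa using ((hasDerivAt_id t).const_mul (-L)).exp
    exact (h1.mul (hD.integral_hasStrictDerivAt 0 t).hasDerivAt).sub
      (hφ.integral_hasStrictDerivAt 0 t).hasDerivAt
  have hanti : AntitoneOn f (Icc 0 T) := by
    refine antitoneOn_of_deriv_nonpos (convex_Icc 0 T)
      (fun t _ => (hf t).continuousAt.continuousWithinAt)
      (fun t _ => (hf t).differentiableAt.differentiableWithinAt) fun t ht => ?_
    rw [(hf t).deriv]
    have ht' := interior_subset ht
    have h1 : Real.exp (-L * t) ≤ 1 := Real.exp_le_one_iff.2 (by nlinarith [ht'.1])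
    have h2 := mul_le_mul_of_nonneg_left (h t ht') (Real.exp_pos (-L * t)).le
    have h3 := mul_le_mul_of_nonneg_right h1 (hφ0 t ht')
    linarith
  have h0 := hanti (left_mem_Icc.2 hT) (right_mem_Icc.2 hT) hT
  have h1 : Real.exp (-L * T) * (∫ τ in (0 : ℝ)..T, D τ) ≤ ∫ τ in (0 : ℝ)..T, φ τ := by
    simpa [f] using h0
  calc ∫ τ in (0 : ℝ)..T, D τ
      = Real.exp (L * T) * (Real.exp (-L * T) * ∫ τ in (0 : ℝ)..T, D τ) := by
        rw [← mul_assoc, ← Real.exp_add]; simp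
    _ ≤ _ := mul_le_mul_of_nonneg_left h1 (Real.exp_pos _).le

theorem continuousOn_norm_primitive {T : ℝ} (hT : 0 ≤ T) {g : ℝ → ℂ}
    (hg : IntervalIntegrable g volume 0 T) :
    ContinuousOn (fun t => ‖∫ τ in (0 : ℝ)..t, g τ‖) (Icc 0 T) := by
  have := intervalIntegral.continuousOn_primitive_interval' hg left_mem_uIcc
  rw [uIcc_of_le hT] at this
  exact this.norm

/-- The `L¹` norm of a primitive is controlled by its values at finitely many equally spaced times
and the `L¹` norm of the integrand.  This expresses the compactness of
`g ↦ (t ↦ ∫₀ᵗ g)` as an operator on `L¹`. -/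
theorem integral_norm_primitive_le {T δ : ℝ} (hT : 0 ≤ T) {g : ℝ → ℂ}
    (hg : IntervalIntegrable g volume 0 T) {N : ℕ} (hN : 0 < N)
    (h : ∀ j : ℕ, j ≤ N → ‖∫ τ in (0 : ℝ)..(j * (T / N)), g τ‖ ≤ δ) :
    ∫ t in (0 : ℝ)..T, ‖∫ τ in (0 : ℝ)..t, g τ‖ ≤
      T * δ + T / N * ∫ τ in (0 : ℝ)..T, ‖g τ‖ := by
  have hN' : (0 : ℝ) < N := by exact_mod_cast hN
  set a : ℕ → ℝ := fun j => j * (T / N)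
  have ha0 : a 0 = 0 := by simp [a]
  have haN : a N = T := by simp only [a]; field_simp
  have hmono : Monotone a := fun i j hij => by
    simp only [a]; gcongr
  have hmem : ∀ j ≤ N, a j ∈ Icc 0 T := fun j hj =>
    ⟨ha0 ▸ hmono (Nat.zero_le j), haN ▸ hmono hj⟩
  have hsub : ∀ {x y}, x ∈ Icc 0 T → y ∈ Icc 0 T → IntervalIntegrable g volume x y :=
    fun hx hy => hg.mono_set (by
      rw [uIcc_of_le hT]; exact uIcc_subset_Icc hx hy)
  have hcont : ContinuousOn (fun t => ‖∫ τ in (0 : ℝ)..t, g τ‖) (Icc 0 T) :=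
    continuousOn_norm_primitive hT hg
  have hint : ∀ j < N, IntervalIntegrable (fun t => ‖∫ τ in (0 : ℝ)..t, g τ‖) volume
      (a j) (a (j + 1)) := fun j hj =>
    (hcont.mono (uIcc_subset_Icc (hmem j hj.le) (hmem (j + 1) hj))).intervalIntegrable
  have hgj : ∀ j < N, IntervalIntegrable (fun t => ‖g t‖) volume (a j) (a (j + 1)) :=
    fun j hj => (hsub (hmem j hj.le) (hmem (j + 1) hj)).norm
  have hstep : ∀ j < N, ∫ t in (a j)..(a (j + 1)), ‖∫ τ in (0 : ℝ)..t, g τ‖ ≤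
      T / N * (δ + ∫ τ in (a j)..(a (j + 1)), ‖g τ‖) := fun j hj => by
    have hj1 := hmem j hj.le
    have hj2 := hmem (j + 1) hj
    have hle : a j ≤ a (j + 1) := hmono (Nat.le_succ j)
    have hlen : a (j + 1) - a j = T / N := by simp only [a]; push_cast; ring
    calc ∫ t in (a j)..(a (j + 1)), ‖∫ τ in (0 : ℝ)..t, g τ‖
        ≤ ∫ t in (a j)..(a (j + 1)), (δ + ∫ τ in (a j)..(a (j + 1)), ‖g τ‖) := by
          refine intervalIntegral.integral_mono_on hle (hint j hj) (by simp) fun t ht => ?_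
          have ht' : t ∈ Icc 0 T := ⟨hj1.1.trans ht.1, ht.2.trans hj2.2⟩
          rw [← intervalIntegral.integral_add_adjacent_intervals
            (hsub (left_mem_Icc.2 hT) hj1) (hsub hj1 ht')]
          refine (norm_add_le _ _).trans (add_le_add (h j hj.le) ?_)
          refine (intervalIntegral.norm_integral_le_integral_norm ht.1).trans ?_
          exact intervalIntegral.integral_mono_interval le_rfl ht.1 ht.2
            (Filter.Eventually.of_forall fun _ => norm_nonneg _) (hgj j hj)
      _ = _ := by rw [intervalIntegral.integral_const, hlen, smul_eq_mul]
  calc ∫ t in (0 : ℝ)..T, ‖∫ τ in (0 : ℝ)..t, g τ‖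
      = ∑ j ∈ Finset.range N, ∫ t in (a j)..(a (j + 1)), ‖∫ τ in (0 : ℝ)..t, g τ‖ := by
        rw [intervalIntegral.sum_integral_adjacent_intervals hint, ha0, haN]
    _ ≤ ∑ j ∈ Finset.range N, T / N * (δ + ∫ τ in (a j)..(a (j + 1)), ‖g τ‖) :=
        Finset.sum_le_sum fun j hj => hstep j (Finset.mem_range.1 hj)
    _ = _ := by
        rw [← Finset.mul_sum, Finset.sum_add_distrib,
          intervalIntegral.sum_integral_adjacent_intervals hgj, ha0, haN]
        simp only [Finset.sum_const, Finset.card_range, nsmul_eq_mul]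
        field_simp

/-! ### Stability of mild solutions -/

/-- The size, in `H^s(𝕋ᵈ)`, of the response at time `t` of the linear equation to the difference
of two controls: the primitives of the controls enter, not the controls themselves. -/
def linearGap (s : ℝ) (K : Finset (Fin d → ℤ)) (v w : (Fin d → ℤ) → ℝ → ℂ) (t : ℝ) : ℝ :=
  ∑ k ∈ K, weight s k * ‖∫ τ in (0 : ℝ)..t, phase k τ * (v k τ - w k τ)‖

theorem linearGap_nonneg (K : Finset (Fin d → ℤ)) (v w : (Fin d → ℤ) → ℝ → ℂ) (t : ℝ) :
    0 ≤ linearGap s K v w t :=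
  Finset.sum_nonneg fun k _ => mul_nonneg (weight_pos s k).le (norm_nonneg _)

theorem continuousOn_linearGap {K : Finset (Fin d → ℤ)} {v w : (Fin d → ℤ) → ℝ → ℂ} {T : ℝ}
    (hT : 0 ≤ T) (hv : ∀ k ∈ K, IntervalIntegrable (v k) volume 0 T)
    (hw : ∀ k ∈ K, IntervalIntegrable (w k) volume 0 T) :
    ContinuousOn (linearGap s K v w) (Icc 0 T) :=
  continuousOn_finsetSum _ fun k hk => continuousOn_const.mul
    (continuousOn_norm_primitive hT (intervalIntegrable_phase_mul ((hv k hk).sub (hw k hk)) k))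

/-- Duhamel's formula for the difference of two mild solutions. -/
theorem norm_sub_le_integral_add_linearGap (hs : 0 ≤ s) {T L : ℝ} {K : Finset (Fin d → ℤ)}
    {v w : (Fin d → ℤ) → ℝ → ℂ} {u₀ : Sobolev d s} {u y : ℝ → Sobolev d s}
    (hv : ∀ k ∈ K, IntervalIntegrable (v k) volume 0 T)
    (hw : ∀ k ∈ K, IntervalIntegrable (w k) volume 0 T)
    (hu : IsMildSolution T (source s K v) u₀ u) (hy : IsMildSolution T (source s K w) u₀ y)
    (hL : ∀ τ ∈ Icc 0 T, ∀ g h : Sobolev d s, IsCubic (u τ) g → IsCubic (y τ) h →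
      ‖g - h‖ ≤ L * ‖u τ - y τ‖) {t : ℝ} (ht : t ∈ Icc 0 T) :
    ‖u t - y t‖ ≤ L * (∫ τ in (0 : ℝ)..t, ‖u τ - y τ‖) + linearGap s K v w t := by
  have := Sobolev.completeSpace (d := d) hs
  have hT : 0 ≤ T := ht.1.trans ht.2
  obtain ⟨huc, G, hG, hGi, hGe⟩ := hu
  obtain ⟨hyc, H, hH, hHi, hHe⟩ := hy
  have hsub : uIcc 0 t ⊆ uIcc 0 T := by
    rw [uIcc_of_le hT, uIcc_of_le ht.1]; exact Icc_subset_Icc_right ht.2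
  have hv' : ∀ k ∈ K, IntervalIntegrable (v k) volume 0 t := fun k hk => (hv k hk).mono_set hsub
  have hw' : ∀ k ∈ K, IntervalIntegrable (w k) volume 0 t := fun k hk => (hw k hk).mono_set hsub
  have hVi := intervalIntegrable_freeFlow_source (s := s) hv'
  have hWi := intervalIntegrable_freeFlow_source (s := s) hw'
  have hGV := hGi.mono_set hsub
  have hHW := hHi.mono_set hsub
  have hN : IntervalIntegrable (fun τ => freeFlow (-τ) (G τ - H τ)) volume 0 t := by
    have := (hGV.sub hHW).sub (hVi.sub hWi)
    refine this.congr fun τ _ => ?_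
    simp only [freeFlow_add, freeFlow_sub]
    abel
  have key : u t - y t = freeFlow t (Complex.I • ((∫ τ in (0 : ℝ)..t, freeFlow (-τ) (G τ - H τ)) +
      ∑ k ∈ K, (∫ τ in (0 : ℝ)..t, phase k τ * (v k τ - w k τ)) • mode d s k)) := by
    have e1 : ∑ k ∈ K, (∫ τ in (0 : ℝ)..t, phase k τ * (v k τ - w k τ)) • mode d s k =
        (∫ τ in (0 : ℝ)..t, freeFlow (-τ) (source s K v τ)) -
          ∫ τ in (0 : ℝ)..t, freeFlow (-τ) (source s K w τ) := by
      rw [integral_freeFlow_source hs hv', integral_freeFlow_source hs hw',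
        ← Finset.sum_sub_distrib]
      refine Finset.sum_congr rfl fun k hk => ?_
      rw [← sub_smul, ← intervalIntegral.integral_sub (intervalIntegrable_phase_mul (hv' k hk) k)
        (intervalIntegrable_phase_mul (hw' k hk) k)]
      simp only [mul_sub]
    have e2 : (∫ τ in (0 : ℝ)..t, freeFlow (-τ) (G τ - H τ)) +
        ((∫ τ in (0 : ℝ)..t, freeFlow (-τ) (source s K v τ)) -
          ∫ τ in (0 : ℝ)..t, freeFlow (-τ) (source s K w τ)) =
        (∫ τ in (0 : ℝ)..t, freeFlow (-τ) (G τ + source s K v τ)) -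
          ∫ τ in (0 : ℝ)..t, freeFlow (-τ) (H τ + source s K w τ) := by
      rw [← intervalIntegral.integral_sub hVi hWi,
        ← intervalIntegral.integral_add hN (hVi.sub hWi),
        ← intervalIntegral.integral_sub hGV hHW]
      refine intervalIntegral.integral_congr fun τ _ => ?_
      simp only [freeFlow_add, freeFlow_sub]
      abel
    rw [e1, e2, hGe t ht, hHe t ht, ← freeFlow_sub, smul_sub, add_sub_add_left_eq_sub]
  rw [key, norm_freeFlow, norm_smul, Complex.norm_I, one_mul]
  refine (norm_add_le _ _).trans (add_le_add ?_ ?_)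
  · rw [← intervalIntegral.integral_const_mul]
    refine intervalIntegral.norm_integral_le_of_norm_le ht.1
      (Filter.Eventually.of_forall fun τ hτ => ?_) ?_
    · rw [norm_freeFlow]
      have hτ' : τ ∈ Icc 0 T := ⟨hτ.1.le, hτ.2.trans ht.2⟩
      exact hL τ hτ' _ _ (hG τ hτ') (hH τ hτ')
    · have hc : ContinuousOn (fun τ => L * ‖u τ - y τ‖) (uIcc 0 t) := by
        rw [uIcc_of_le hT] at hsub
        exact (continuousOn_const.mul (huc.sub hyc).norm).mono hsub
      exact hc.intervalIntegrable
  · refine (norm_sum_le _ _).trans (Finset.sum_le_sum fun k _ => ?_)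
    rw [norm_smul, mul_comm]
    exact mul_le_mul_of_nonneg_right (norm_mode_le k) (norm_nonneg _)

/-- The solution at the final time depends continuously on the primitives of the controls, in the
`L¹` topology and at the final time. -/
theorem norm_sub_le_of_isMildSolution (hs : 0 ≤ s) {T L : ℝ} (hT : 0 ≤ T) (hL0 : 0 ≤ L)
    {K : Finset (Fin d → ℤ)}
    {v w : (Fin d → ℤ) → ℝ → ℂ} {u₀ : Sobolev d s} {u y : ℝ → Sobolev d s}
    (hv : ∀ k ∈ K, IntervalIntegrable (v k) volume 0 T)
    (hw : ∀ k ∈ K, IntervalIntegrable (w k) volume 0 T)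
    (hu : IsMildSolution T (source s K v) u₀ u) (hy : IsMildSolution T (source s K w) u₀ y)
    (hL : ∀ τ ∈ Icc 0 T, ∀ g h : Sobolev d s, IsCubic (u τ) g → IsCubic (y τ) h →
      ‖g - h‖ ≤ L * ‖u τ - y τ‖) :
    ‖u T - y T‖ ≤ L * (Real.exp (L * T) * ∫ t in (0 : ℝ)..T, linearGap s K v w t) +
      linearGap s K v w T := by
  have h := fun t (ht : t ∈ Icc 0 T) =>
    norm_sub_le_integral_add_linearGap hs hv hw hu hy hL ht
  refine (h T (right_mem_Icc.2 hT)).trans ?_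
  gcongr
  exact integral_le_exp_mul_integral hT hL0 (hu.1.sub hy.1).norm
    (continuousOn_linearGap hT hv hw) (fun t _ => linearGap_nonneg K v w t) h

theorem integral_linearGap_le {K : Finset (Fin d → ℤ)} {v w : (Fin d → ℤ) → ℝ → ℂ} {T R δ : ℝ}
    (hT : 0 ≤ T) (hv : ∀ k ∈ K, IntervalIntegrable (v k) volume 0 T)
    (hw : ∀ k ∈ K, IntervalIntegrable (w k) volume 0 T)
    (hvR : ∀ k ∈ K, ∫ τ in (0 : ℝ)..T, ‖v k τ‖ ≤ R) (hwR : ∀ k ∈ K, ∫ τ in (0 : ℝ)..T, ‖w k τ‖ ≤ R)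
    {N : ℕ} (hN : 0 < N)
    (h : ∀ k ∈ K, ∀ j : ℕ, j ≤ N →
      ‖∫ τ in (0 : ℝ)..(j * (T / N)), phase k τ * (v k τ - w k τ)‖ ≤ δ) :
    ∫ t in (0 : ℝ)..T, linearGap s K v w t ≤
      (∑ k ∈ K, weight s k) * (T * δ + T / N * (2 * R)) := by
  have hi : ∀ k ∈ K, IntervalIntegrable (fun τ => phase k τ * (v k τ - w k τ)) volume 0 T :=
    fun k hk => intervalIntegrable_phase_mul ((hv k hk).sub (hw k hk)) k
  unfold linearGap
  rw [intervalIntegral.integral_finsetSum, Finset.sum_mul]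
  · refine Finset.sum_le_sum fun k hk => ?_
    rw [intervalIntegral.integral_const_mul]
    refine mul_le_mul_of_nonneg_left ?_ (weight_pos s k).le
    refine (integral_norm_primitive_le hT (hi k hk) hN (h k hk)).trans ?_
    gcongr
    calc ∫ τ in (0 : ℝ)..T, ‖phase k τ * (v k τ - w k τ)‖
        ≤ ∫ τ in (0 : ℝ)..T, (‖v k τ‖ + ‖w k τ‖) := by
          refine intervalIntegral.integral_mono_on hT (hi k hk).norm
            ((hv k hk).norm.add (hw k hk).norm) fun τ _ => ?_
          rw [norm_mul, norm_phase, one_mul]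
          exact norm_sub_le _ _
      _ ≤ 2 * R := by
          rw [intervalIntegral.integral_add (hv k hk).norm (hw k hk).norm]
          linarith [hvR k hk, hwR k hk]
  · intro k hk
    have hc := continuousOn_norm_primitive hT (hi k hk)
    rw [← uIcc_of_le hT] at hc
    exact (continuousOn_const.mul hc).intervalIntegrable

/-! ### Compactness of the attainable set -/

/-- The points reached at time `T` with controls of `L¹` norm at most `R` along mild solutions that
stay in the ball of radius `R`. -/
def boundedReach (K : Finset (Fin d → ℤ)) (T R : ℝ) (u₀ : Sobolev d s) : Set (Sobolev d s) :=
  {x | ∃ (v : (Fin d → ℤ) → ℝ → ℂ) (u : ℝ → Sobolev d s),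
    (∀ k ∈ K, IntervalIntegrable (v k) volume 0 T) ∧
    (∀ k ∈ K, ∫ τ in (0 : ℝ)..T, ‖v k τ‖ ≤ R) ∧
    IsMildSolution T (source s K v) u₀ u ∧ (∀ t ∈ Icc 0 T, ‖u t‖ ≤ R) ∧ u T = x}

theorem totallyBounded_boundedReach (hs : (d : ℝ) / 2 < s) (K : Finset (Fin d → ℤ)) {T R : ℝ}
    (hT : 0 ≤ T) (hR : 0 ≤ R) (u₀ : Sobolev d s) : TotallyBounded (boundedReach K T R u₀) := by
  have hs0 : 0 ≤ s := le_trans (by positivity) hs.le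
  obtain ⟨C, hC0, hC⟩ := exists_norm_cubic_sub_le (s := s) hs
  refine Metric.totallyBounded_of_finite_discretization fun ε hε => ?_
  set L := C * R ^ 2
  have hL0 : 0 ≤ L := by positivity
  set W := ∑ k ∈ K, weight s k with hW
  have hW0 : 0 ≤ W := Finset.sum_nonneg fun k _ => (weight_pos s k).le
  set B := W * (L * (Real.exp (L * T) * (T + T * (2 * R))) + 1) with hB
  -- With `N` equally spaced samples, known up to `1 / N`, the final state is known up to `B / N`.
  obtain ⟨n, hn⟩ := exists_nat_gt (B / ε)
  set N := n + 1
  have hN : 0 < N := Nat.succ_pos n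
  have hN' : (0 : ℝ) < N := by exact_mod_cast hN
  have hBN : B * (1 / N) < ε := by
    have h1 : B / ε < N := hn.trans (by simp [N])
    rw [div_lt_iff₀ hε] at h1
    rw [mul_one_div, div_lt_iff₀ hN', mul_comm]; exact h1
  choose v u hv hvR hu huR hux using fun x : boundedReach K T R u₀ => x.2
  let S : boundedReach K T R u₀ → (K × Fin (N + 1) → ℂ) := fun x p =>
    ∫ τ in (0 : ℝ)..((p.2 : ℕ) * (T / N)), phase p.1.1 τ * v x p.1.1 τ
  have htime : ∀ j ≤ N, (j : ℝ) * (T / N) ∈ Icc 0 T := fun j hj => by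
    have hj' : (j : ℝ) ≤ N := by exact_mod_cast hj
    refine ⟨by positivity, ?_⟩
    calc (j : ℝ) * (T / N) ≤ N * (T / N) := by gcongr
      _ = T := by field_simp
  have hsub : ∀ j ≤ N, uIcc 0 ((j : ℝ) * (T / N)) ⊆ uIcc 0 T := fun j hj => by
    rw [uIcc_of_le hT]
    exact uIcc_subset_Icc (left_mem_Icc.2 hT) (htime j hj)
  have hi : ∀ x, ∀ k ∈ K, ∀ j ≤ N,
      IntervalIntegrable (fun τ => phase k τ * v x k τ) volume 0 ((j : ℝ) * (T / N)) :=
    fun x k hk j hj => (intervalIntegrable_phase_mul (hv x k hk) k).mono_set (hsub j hj)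
  have hS : ∀ x, S x ∈ Metric.closedBall (0 : K × Fin (N + 1) → ℂ) R := fun x => by
    rw [mem_closedBall_zero_iff, pi_norm_le_iff_of_nonneg hR]
    rintro ⟨⟨k, hk⟩, j⟩
    have hj : (j : ℕ) ≤ N := Nat.lt_succ_iff.1 j.2
    calc ‖∫ τ in (0 : ℝ)..((j : ℕ) * (T / N)), phase k τ * v x k τ‖
        ≤ ∫ τ in (0 : ℝ)..((j : ℕ) * (T / N)), ‖phase k τ * v x k τ‖ :=
          intervalIntegral.norm_integral_le_integral_norm (htime j hj).1
      _ = ∫ τ in (0 : ℝ)..((j : ℕ) * (T / N)), ‖v x k τ‖ := by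
          simp only [norm_mul, norm_phase, one_mul]
      _ ≤ ∫ τ in (0 : ℝ)..T, ‖v x k τ‖ :=
          intervalIntegral.integral_mono_interval le_rfl (htime j hj).1 (htime j hj).2
            (Filter.Eventually.of_forall fun _ => norm_nonneg _) (hv x k hk).norm
      _ ≤ R := hvR x k hk
  obtain ⟨t, htf, htc⟩ := Metric.totallyBounded_iff.1
    (isCompact_closedBall (0 : K × Fin (N + 1) → ℂ) R).totallyBounded (1 / N / 2) (by positivity)
  have hcov : ∀ x, ∃ y : t, dist (S x) y < 1 / N / 2 := fun x => by
    obtain ⟨y, hy, hxy⟩ := mem_iUnion₂.1 (htc (hS x))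
    exact ⟨⟨y, hy⟩, hxy⟩
  choose F hF using hcov
  refine ⟨t, htf.fintype, F, fun x y hxy => ?_⟩
  have hdist : dist (S x) (S y) < 1 / N := by
    have h1 := hF x
    have h2 := hF y
    rw [← hxy] at h2
    linarith [dist_triangle_right (S x) (S y) (F x)]
  have hsample : ∀ k ∈ K, ∀ j : ℕ, j ≤ N →
      ‖∫ τ in (0 : ℝ)..(j * (T / N)), phase k τ * (v x k τ - v y k τ)‖ ≤ 1 / N := by
    intro k hk j hj
    have h1 := (dist_le_pi_dist (S x) (S y) (⟨k, hk⟩, ⟨j, Nat.lt_succ_of_le hj⟩)).trans hdist.le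
    rw [dist_eq_norm] at h1
    simp only [S] at h1
    rw [← intervalIntegral.integral_sub (hi x k hk j hj) (hi y k hk j hj)] at h1
    simpa only [mul_sub] using h1
  have hmain := norm_sub_le_of_isMildSolution hs0 hT hL0 (hv x) (hv y) (hu x) (hu y)
    fun τ hτ g h hg hh => hC R _ _ g h (huR x τ hτ) (huR y τ hτ) hg hh
  have hint := integral_linearGap_le (s := s) hT (hv x) (hv y) (hvR x) (hvR y) hN hsample
  have hend : linearGap s K (v x) (v y) T ≤ W * (1 / N) := by
    rw [linearGap, hW, Finset.sum_mul]
    refine Finset.sum_le_sum fun k hk => mul_le_mul_of_nonneg_left ?_ (weight_pos s k).le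
    have := hsample k hk N le_rfl
    rwa [mul_div_cancel₀ T hN'.ne'] at this
  rw [dist_eq_norm, ← hux x, ← hux y]
  calc _ ≤ _ := hmain
    _ ≤ L * (Real.exp (L * T) * (W * (T * (1 / N) + T / N * (2 * R)))) + W * (1 / N) := by
        gcongr
    _ = B * (1 / N) := by rw [hB]; ring
    _ < ε := hBN

/-- Every attainable point is reached with a bound on the controls and the solution. -/
theorem attainableSet_subset_iUnion_boundedReach (K : Finset (Fin d → ℤ)) {T : ℝ} (hT : 0 ≤ T)
    (u₀ : Sobolev d s) {𝒱 : Set (ℝ → ℂ)} (h𝒱 : ∀ v ∈ 𝒱, IntegrableOn v (Icc 0 T)) :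
    attainableSet K 𝒱 T u₀ ⊆ ⋃ n : ℕ, boundedReach K T n u₀ := by
  rintro x ⟨v, hv, u, hu, -, hux⟩
  obtain ⟨R, hR⟩ := isCompact_Icc.exists_bound_of_continuousOn hu.1
  obtain ⟨n, hn⟩ := exists_nat_ge (max R (∑ k ∈ K, ∫ τ in (0 : ℝ)..T, ‖v k τ‖))
  refine mem_iUnion.2 ⟨n, v, u, fun k hk => ?_, fun k hk => ?_, hu, fun t ht => ?_, hux⟩
  · exact (intervalIntegrable_iff_integrableOn_Icc_of_le hT).2 (h𝒱 _ (hv k hk))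
  · refine le_trans ?_ ((le_max_right _ _).trans hn)
    exact Finset.single_le_sum (f := fun k => ∫ τ in (0 : ℝ)..T, ‖v k τ‖)
      (fun k _ => intervalIntegral.integral_nonneg hT fun _ _ => norm_nonneg _) hk
  · exact (hR t ht).trans ((le_max_left _ _).trans hn)

/-! ### Compact sets are meagre in `H^s(𝕋ᵈ)` -/

theorem not_finiteDimensional_sobolev (hd : 1 ≤ d) (s : ℝ) :
    ¬ FiniteDimensional ℂ (Sobolev d s) := fun _ => by
  have : Nonempty (Fin d) := ⟨⟨0, hd⟩⟩
  have : Finite (Fin d → ℤ) := (linearIndependent_mode d s).finite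
  exact not_finite (Fin d → ℤ)

theorem dense_compl_of_isCompact (hd : 1 ≤ d) {C : Set (Sobolev d s)} (hC : IsCompact C) :
    Dense Cᶜ := by
  rw [← interior_eq_empty_iff_dense_compl, eq_empty_iff_forall_notMem]
  intro x hx
  obtain ⟨r, hr, hsub⟩ := Metric.nhds_basis_closedBall.mem_iff.1 (mem_interior_iff_mem_nhds.1 hx)
  exact not_finiteDimensional_sobolev hd s
    (.of_isCompact_closedBall ℂ hr (hC.of_isClosed_subset Metric.isClosed_closedBall hsub))

end TorusNLS

end

theorem mainTheorem2 (d : ℕ) (hd : 1 ≤ d) (K : Finset (Fin d → ℤ)) (s : ℝ) (hs : (d : ℝ) / 2 < s)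
    (T : ℝ) (hT : 0 < T) (u₀ : TorusNLS.Sobolev d s)
    (𝒱 : Set (ℝ → ℂ)) (h𝒱 : ∀ v ∈ 𝒱, IntegrableOn v (Icc 0 T)) :
    (∃ C : ℕ → Set (TorusNLS.Sobolev d s), (∀ n, IsCompact (C n)) ∧
      TorusNLS.attainableSet K 𝒱 T u₀ ⊆ ⋃ n, C n) ∧
    Dense (TorusNLS.attainableSet K 𝒱 T u₀)ᶜ ∧
    ¬ TorusNLS.ExactlyControllable K 𝒱 T u₀ := by
  have := TorusNLS.Sobolev.completeSpace (d := d) (s := s) (le_trans (by positivity) hs.le)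
  let C : ℕ → Set (TorusNLS.Sobolev d s) := fun n =>
    closure (TorusNLS.boundedReach K T n u₀)
  have hC : ∀ n, IsCompact (C n) := fun n =>
    (TorusNLS.totallyBounded_boundedReach hs K hT.le n.cast_nonneg u₀).closure.isCompact_of_isClosed
      isClosed_closure
  have hsub : TorusNLS.attainableSet K 𝒱 T u₀ ⊆ ⋃ n, C n :=
    (TorusNLS.attainableSet_subset_iUnion_boundedReach K hT.le u₀ h𝒱).trans
      (iUnion_mono fun n => subset_closure)
  have hdense : Dense (TorusNLS.attainableSet K 𝒱 T u₀)ᶜ := by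
    refine (dense_iInter_of_isOpen (fun n => (hC n).isClosed.isOpen_compl)
      fun n => TorusNLS.dense_compl_of_isCompact hd (hC n)).mono ?_
    rw [← compl_iUnion]
    exact compl_subset_compl.2 hsub
  refine ⟨⟨C, hC, hsub⟩, hdense, fun h => ?_⟩
  rw [h, compl_univ] at hdense
  exact hdense.nonempty.ne_empty rfl
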